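/- Let $a,b\in\mathbf{Z}$ be such that $b$ and $a^2-4b$ are squarefree, let $E$ be the elliptic curve $y^2=x^3+ax^2+bx$ over $\mathbf{Q}$, and let $P\in 2E(\mathbf{Q})$ be a point of infinite order. For $n\in\mathbf{Z}\setminus\{0\}$ write $nP=(x_n,y_n)$. Then there are integers $A_n,B_n,C_n$ ($n\neq 0$) with $B_n\neq 0$, $\gcd(A_n,B_n)=\gcd(B_n,C_n)=1$ and $$nP=(x_n,y_n)=\left(\left(\frac{A_n}{B_n}\right)^2,\ \frac{A_nC_n}{B_n^3}\right)\qquad(n\neq 0);$$ in particular $x_n$ is the square of a rational number, and $\sqrt{x_n}$ denotes either of its square roots. For every choice of such integers the following holds. Let $R$ be a set of prime numbers, identified with the corresponding normalized $p$-adic valuations of $\mathbf{Q}$, such that $\{C_\ast\}$ is $R$-odd-primitive, i.e. for every integer $n\geq 1$ there is a $v\in R$ such that $v(C_n)$ is odd and $v(C_i)=0$ for all $1\leq i<n$. For $x,y\in\mathbf{Q}$ let $\mathcal{D}_R(x,y)$ be the statement: for all $v\in R$, if $v(x)$ is odd, then $v(x)<v(y^2)$ (with $v(0)=\infty$, which is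 not odd). Then for all integers $m\neq 0$ and $n$, $$m\mid n\iff \mathcal{D}_R\big(y_m\sqrt{x_m},\,y_n\sqrt{x_n}\big)\ \text{ or }\ \mathcal{D}_R\big(y_m\sqrt{x_m},\,y_{m+n}\sqrt{x_{m+n}}\big),$$ where a predicate that involves the point at infinity (which happens for the first one if $n=0$, for the second one if $m+n=0$) counts as not satisfied. -/

import Mathlib

namespace OddDiv

/-- The Weierstrass curve `y² = x³ + a x² + b x` over `ℚ`, with `a, b` integers. Its discriminant
is `16 b² (a² - 4b)`, so it is an elliptic curve as soon as `b` and `a² - 4b` are nonzero. -/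
def curve (a b : ℤ) : WeierstrassCurve ℚ where
  a₁ := 0
  a₂ := a
  a₃ := 0
  a₄ := b
  a₆ := 0

theorem curve_Δ (a b : ℤ) : (curve a b).Δ = 16 * (b : ℚ) ^ 2 * ((a : ℚ) ^ 2 - 4 * b) := by
  simp only [curve, WeierstrassCurve.Δ, WeierstrassCurve.b₂, WeierstrassCurve.b₄,
    WeierstrassCurve.b₆, WeierstrassCurve.b₈]
  ring

/-- The group of rational points of `y² = x³ + a x² + b x`. -/
abbrev Pt (a b : ℤ) : Type := (curve a b).toAffine.Point

/-- `A`, `B`, `C` are integer sequences with `nP = ((A_n / B_n)², A_n C_n / B_n³)`,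
`(A_n, B_n) = 1` and `(B_n, C_n) = 1`, for all nonzero integers `n`. They are determined by `P`
up to signs; the (irrelevant) values at `n = 0`, where `nP` is the point at infinity, are left
free. -/
def Represents {a b : ℤ} (P : Pt a b) (A B C : ℤ → ℤ) : Prop :=
  ∀ n : ℤ, n ≠ 0 → B n ≠ 0 ∧ IsCoprime (A n) (B n) ∧ IsCoprime (B n) (C n) ∧
    ∃ h : (curve a b).toAffine.Nonsingular
        (((A n : ℚ) / (B n : ℚ)) ^ 2) ((A n : ℚ) * (C n : ℚ) / (B n : ℚ) ^ 3),
      n • P = WeierstrassCurve.Affine.Point.some _ _ h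

/-- `{X_*}` is `R`-odd-primitive: every term `X_n` (`n ≥ 1`) has a primitive odd order divisor
from the set of primes `R`. -/
def OddPrimitive (R : Set Nat.Primes) (X : ℤ → ℤ) : Prop :=
  ∀ n : ℤ, 0 < n → ∃ p ∈ R, Odd (padicValInt (p : ℕ) (X n)) ∧
    ∀ i : ℤ, 0 < i → i < n → ¬ ((p : ℕ) : ℤ) ∣ X i

/-- The `R`-divisibility predicate on rational numbers: for all `v ∈ R`, if `v(x)` is odd then
`v(x) < v(y²)`; here `v(0) = ∞`, which is not odd. -/
def DivPred (R : Set Nat.Primes) (x y : ℚ) : Prop :=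
  ∀ p ∈ R, Odd (padicValRat (p : ℕ) x) →
    (y = 0 ∨ padicValRat (p : ℕ) x < padicValRat (p : ℕ) (y ^ 2))

/-- `t` is a value of `y √x` at the affine point `Q = (x, y)`, for one of the rational square
roots of `x`. -/
def IsYSqrtX {a b : ℤ} (Q : Pt a b) (t : ℚ) : Prop :=
  ∃ (x y : ℚ) (h : (curve a b).toAffine.Nonsingular x y) (s : ℚ),
    Q = WeierstrassCurve.Affine.Point.some x y h ∧ s ^ 2 = x ∧ t = y * s

/-- The predicate `D_R(y √x, y' √x')` for two points `(x, y)`, `(x', y')`. Changing the sign of a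
square root does not affect it. It is false if one of the points is the point at infinity. -/
def PointDivPred {a b : ℤ} (R : Set Nat.Primes) (Q Q' : Pt a b) : Prop :=
  ∃ t t' : ℚ, IsYSqrtX Q t ∧ IsYSqrtX Q' t' ∧ DivPred R t t'

end OddDiv

/-!
With `u = A / B` and `v = C / B²`, a point `((A / B)², A C / B³)` of `y² = x³ + a x² + b x` is the
image `(u², uv)` of a point of the Jacobi quartic `v² = u⁴ + a u² + b`, so that
`C² = A⁴ + a A² B² + b B⁴` (`QuarticTriple`). Duplication gives `x(2Q) = ((x² - b) / 2y)²`, so all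
points of infinite order in `2E(ℚ)` are of this form (`exists_represents`). Because `b` is
squarefree, `A`, `B`, `C` are pairwise coprime.

On the quartic the first coordinate of a sum is, up to sign,
`A₃ / B₃ = (A₁²A₂² - b B₁²B₂²) / (A₁B₁C₂ + A₂B₂C₁)` (`x_add`). This one formula replaces the theory
of reduction and of the formal group. For every integer `d`, it shows that

* the indices `k` with `d ∣ B_k`, together with `0`, form a subgroup of `ℤ`, the kernel of reduction
  modulo `d` (`QuarticSequence.kernel`);
* adding an element of the kernel preserves `d ∣ C_k` (`dvd_C_add_of_mem`);
* if `d ∣ C_k` or `d ∣ A_k`, then `2k` is in the kernel (`two_mul_mem_of_dvd_C`,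
  `two_mul_mem_of_dvd_A`). Here the denominators `A⁴ - b B⁴` are prime to `d` since `b` and
  `a² - 4b` are squarefree.

Hence `C_m ∣ C_n` if `n` is an odd multiple of `m` (`dvd_C_of_odd_mul`), and a primitive divisor of
`C_m` divides `A_n C_n` only if `m ∣ n` (`index_dvd_of_dvd`). Since `y_n √x_n = ± A_n² C_n / B_n⁴`
has odd valuation only at primes dividing `C_n`, where this valuation is that of `C_n`, these two
facts give the two directions: when `m ∣ n`, one of `n / m` and `(m + n) / m` is odd.
-/

namespace OddDiv

open WeierstrassCurve.Affine

/-! ### Coprime triples on the Jacobi quartic -/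

/-- The integral triple `(A, B, C)`, with `A`, `B` and `B`, `C` coprime, gives the point
`(A / B, C / B²)` of the Jacobi quartic `v² = u⁴ + a u² + b`. -/
structure QuarticTriple (a b A B C : ℤ) : Prop where
  B_ne_zero : B ≠ 0
  coprime_AB : IsCoprime A B
  coprime_BC : IsCoprime B C
  eq : C ^ 2 = A ^ 4 + a * A ^ 2 * B ^ 2 + b * B ^ 4

namespace QuarticTriple

variable {a b A B C A₁ B₁ C₁ A₂ B₂ C₂ A₃ B₃ C₃ d : ℤ}

/-- A prime `p` dividing both `A` and `C` satisfies `p² ∣ b B⁴`, hence `p² ∣ b`. -/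
theorem coprime_AC (h : QuarticTriple a b A B C) (hb : Squarefree b) : IsCoprime A C := by
  refine isCoprime_of_prime_dvd (fun h0 => ?_) fun p hp hA hC => ?_
  · have h4 : b * B ^ 4 = 0 := by
      have := h.eq
      rw [h0.1, h0.2] at this
      linarith
    rcases mul_eq_zero.1 h4 with h5 | h5
    · exact hb.ne_zero h5
    · exact h.B_ne_zero (pow_eq_zero_iff (by norm_num) |>.1 h5)
  · have h1 : p * p ∣ b * B ^ 4 := by
      obtain ⟨x, rfl⟩ := hA
      obtain ⟨y, rfl⟩ := hC
      exact ⟨y ^ 2 - p ^ 2 * x ^ 4 - a * x ^ 2 * B ^ 2, by linear_combination -h.eq⟩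
    have hc : IsCoprime p B := h.coprime_AB.of_isCoprime_of_dvd_left hA
    exact hp.not_isUnit (hb p ((hc.mul_left hc).pow_right.dvd_of_dvd_mul_right h1))

/-- No prime `p ∣ C` divides the numerator `A⁴ - b B⁴` of the duplication formula: it would divide
`2A² + aB²`, and then `(2A² + aB²)² - 4C² = (a² - 4b) B⁴` would be divisible by `p²`, although
`a² - 4b` is squarefree and `p ∤ B`. -/
theorem coprime_C_double (h : QuarticTriple a b A B C) (hb : Squarefree b)
    (hab : Squarefree (a ^ 2 - 4 * b)) : IsCoprime C (A ^ 4 - b * B ^ 4) := by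
  have hAC := h.coprime_AC hb
  refine isCoprime_of_prime_dvd (fun h0 => ?_) fun p hp hC hD => ?_
  · -- Here `A` and `B` are units by coprimality with `C = 0`, so `b = 1`, `a = -2` and
    -- `a² - 4b = 0`.
    have hA : IsUnit A := by
      have := hAC
      rw [h0.1] at this
      exact isCoprime_zero_right.1 this
    have hB : IsUnit B := by
      have := h.coprime_BC
      rw [h0.1] at this
      exact isCoprime_zero_right.1 this
    have hA2 : A ^ 2 = 1 := Int.isUnit_sq hA
    have hB2 : B ^ 2 = 1 := Int.isUnit_sq hB
    have e1 := h.eq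
    have e2 := h0.2
    rw [h0.1, show A ^ 4 = (A ^ 2) ^ 2 by ring, show B ^ 4 = (B ^ 2) ^ 2 by ring, hA2, hB2] at e1
    rw [show A ^ 4 = (A ^ 2) ^ 2 by ring, show B ^ 4 = (B ^ 2) ^ 2 by ring, hA2, hB2] at e2
    have hb1 : b = 1 := by linarith
    have ha : a = -2 := by linarith
    refine hab.ne_zero ?_
    rw [ha, hb1]
    norm_num
  · have hpA : IsCoprime p A := (hAC.symm).of_isCoprime_of_dvd_left hC
    have hpB : IsCoprime p B := (h.coprime_BC.symm).of_isCoprime_of_dvd_left hC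
    have h1 : p ∣ A ^ 2 * (2 * A ^ 2 + a * B ^ 2) := by
      have : A ^ 2 * (2 * A ^ 2 + a * B ^ 2) = C * C + (A ^ 4 - b * B ^ 4) := by
        linear_combination -h.eq
      rw [this]
      exact (hC.mul_right C).add hD
    have h2 : p ∣ 2 * A ^ 2 + a * B ^ 2 := hpA.pow_right.dvd_of_dvd_mul_left h1
    have h3 : p * p ∣ (a ^ 2 - 4 * b) * B ^ 4 := by
      have : (a ^ 2 - 4 * b) * B ^ 4 =
          (2 * A ^ 2 + a * B ^ 2) * (2 * A ^ 2 + a * B ^ 2) - 4 * (C * C) := by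
        linear_combination 4 * h.eq
      rw [this]
      exact (mul_dvd_mul h2 h2).sub ((mul_dvd_mul hC hC).mul_left 4)
    exact hp.not_isUnit (hab p ((hpB.mul_left hpB).pow_right.dvd_of_dvd_mul_right h3))

/-- A prime dividing `A` divides neither `B` nor `b`: if it divided `b`, it would divide `C`. -/
theorem coprime_A_double (h : QuarticTriple a b A B C) (hb : Squarefree b) :
    IsCoprime A (A ^ 4 - b * B ^ 4) := by
  have h1 : IsCoprime A (C ^ 2 - A * (A ^ 3 + a * A * B ^ 2)) := by
    have := (h.coprime_AC hb).pow_right (n := 2)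
    have h2 := this.add_mul_left_right (-(A ^ 3 + a * A * B ^ 2))
    convert! h2 using 1
    ring
  have h3 : IsCoprime A (-(b * B ^ 4)) := by
    convert! h1.neg_right using 1
    linear_combination h.eq
  have h4 := h3.add_mul_left_right (A ^ 3)
  convert! h4 using 1
  ring

/-- `A₃ / B₃` is, up to sign, `(A₁²A₂² - bB₁²B₂²) / (A₁B₁C₂ + A₂B₂C₁)`, the first coordinate of
the sum of two points of the Jacobi quartic. -/
def SumRel (b A₁ B₁ C₁ A₂ B₂ C₂ A₃ B₃ : ℤ) : Prop :=
  A₃ ^ 2 * (A₁ * B₁ * C₂ + A₂ * B₂ * C₁) ^ 2 = B₃ ^ 2 * (A₁ ^ 2 * A₂ ^ 2 - b * B₁ ^ 2 * B₂ ^ 2) ^ 2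

theorem SumRel.dvd (h : SumRel b A₁ B₁ C₁ A₂ B₂ C₂ A₃ B₃)
    (hN : d ∣ A₁ * B₁ * C₂ + A₂ * B₂ * C₁)
    (hD : IsCoprime d (A₁ ^ 2 * A₂ ^ 2 - b * B₁ ^ 2 * B₂ ^ 2)) : d ∣ B₃ := by
  have h1 : d ^ 2 ∣ B₃ ^ 2 * (A₁ ^ 2 * A₂ ^ 2 - b * B₁ ^ 2 * B₂ ^ 2) ^ 2 := by
    rw [← h]
    exact (pow_dvd_pow_of_dvd hN 2).mul_left _
  exact (Int.pow_dvd_pow_iff two_ne_zero).1 (hD.pow.dvd_of_dvd_mul_right h1)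

/-- The points reducing to the origin modulo `d` are closed under addition. -/
theorem dvd_B_add (h₁ : QuarticTriple a b A₁ B₁ C₁) (h₂ : QuarticTriple a b A₂ B₂ C₂)
    (h : SumRel b A₁ B₁ C₁ A₂ B₂ C₂ A₃ B₃) (hd₁ : d ∣ B₁) (hd₂ : d ∣ B₂) : d ∣ B₃ := by
  refine h.dvd (((hd₁.mul_left _).mul_right _).add ((hd₂.mul_left _).mul_right _)) ?_
  have c₁ : IsCoprime d A₁ := h₁.coprime_AB.symm.of_isCoprime_of_dvd_left hd₁
  have c₂ : IsCoprime d A₂ := h₂.coprime_AB.symm.of_isCoprime_of_dvd_left hd₂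
  obtain ⟨x, rfl⟩ := hd₁
  have := (c₁.pow_right (n := 2)).mul_right (c₂.pow_right (n := 2)) |>.add_mul_left_right
    (-(b * d * x ^ 2 * B₂ ^ 2))
  convert! this using 1
  ring

/-- Adding a point that reduces to the origin modulo `d` to one with `C ≡ 0` preserves `C ≡ 0`:
the addition formula gives `B₃²A₁² ≡ A₃²B₁²` modulo `d²`, so `A₁⁴C₃² ≡ A₃⁴C₁²` by the equation of
the quartic. -/
theorem dvd_C_add (h₁ : QuarticTriple a b A₁ B₁ C₁) (h₂ : QuarticTriple a b A₂ B₂ C₂)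
    (h₃ : QuarticTriple a b A₃ B₃ C₃) (hb : Squarefree b)
    (h : SumRel b A₁ B₁ C₁ A₂ B₂ C₂ A₃ B₃) (hd₁ : d ∣ C₁) (hd₂ : d ∣ B₂) : d ∣ C₃ := by
  have c₁ : IsCoprime d A₁ := (h₁.coprime_AC hb).symm.of_isCoprime_of_dvd_left hd₁
  have c₂ : IsCoprime d A₂ := h₂.coprime_AB.symm.of_isCoprime_of_dvd_left hd₂
  have e₁ := h₁.eq
  have e₂ := h₂.eq
  have e₃ := h₃.eq
  unfold SumRel at h
  obtain ⟨x, rfl⟩ := hd₁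
  obtain ⟨y, rfl⟩ := hd₂
  have k1 : d ^ 2 ∣ (A₁ ^ 2 * A₂ ^ 4) * (A₃ ^ 2 * B₁ ^ 2 - B₃ ^ 2 * A₁ ^ 2) := by
    refine ⟨-(A₃ ^ 2 * A₁ ^ 2 * B₁ ^ 2 * (a * A₂ ^ 2 * y ^ 2 + b * d ^ 2 * y ^ 4)
      + A₃ ^ 2 * (2 * A₁ * B₁ * C₂ * A₂ * y * x + A₂ ^ 2 * y ^ 2 * d ^ 2 * x ^ 2))
      + B₃ ^ 2 * (-2 * A₁ ^ 2 * A₂ ^ 2 * b * B₁ ^ 2 * y ^ 2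
        + b ^ 2 * B₁ ^ 4 * d ^ 2 * y ^ 4), ?_⟩
    linear_combination h - A₃ ^ 2 * A₁ ^ 2 * B₁ ^ 2 * e₂
  have cc : IsCoprime (d ^ 2) (A₁ ^ 2 * A₂ ^ 4) := (c₁.pow).mul_right (c₂.pow)
  obtain ⟨z, hz⟩ := cc.dvd_of_dvd_mul_left k1
  have k2 : d ^ 2 ∣ C₃ ^ 2 * A₁ ^ 4 := by
    refine ⟨A₃ ^ 4 * x ^ 2 - a * A₁ ^ 2 * A₃ ^ 2 * z - b * z * (A₃ ^ 2 * B₁ ^ 2 + B₃ ^ 2 * A₁ ^ 2),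
      ?_⟩
    linear_combination A₁ ^ 4 * e₃ - A₃ ^ 4 * e₁
      - (a * A₁ ^ 2 * A₃ ^ 2 + b * (A₃ ^ 2 * B₁ ^ 2 + B₃ ^ 2 * A₁ ^ 2)) * hz
  exact (Int.pow_dvd_pow_iff two_ne_zero).1 ((c₁.pow).dvd_of_dvd_mul_right k2)

/-- A point with `AC ≡ 0` modulo `d` becomes the origin modulo `d` after doubling, as long as the
numerator of the duplication formula is invertible. -/
theorem dvd_B_double (h : SumRel b A B C A B C A₃ B₃) (hd : d ∣ A * C)
    (hD : IsCoprime d (A ^ 4 - b * B ^ 4)) : d ∣ B₃ := by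
  refine h.dvd ?_ ?_
  · have := hd.mul_left (2 * B)
    convert! this using 1
    ring
  · convert! hD using 1
    ring

/-- The square of the first coordinate determines a coprime triple up to signs. -/
theorem sq_eq_of_ratio (h₁ : QuarticTriple a b A₁ B₁ C₁) (h₂ : QuarticTriple a b A₂ B₂ C₂)
    (h : A₁ ^ 2 * B₂ ^ 2 = A₂ ^ 2 * B₁ ^ 2) : B₁ ^ 2 = B₂ ^ 2 ∧ C₁ ^ 2 = C₂ ^ 2 := by
  have key : ∀ {A B A' B' : ℤ}, IsCoprime A B → A ^ 2 * B' ^ 2 = A' ^ 2 * B ^ 2 → B ∣ B' := by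
    intro A B A' B' hc he
    have : B ^ 2 ∣ A ^ 2 * B' ^ 2 := ⟨A' ^ 2, by rw [he]; ring⟩
    exact (Int.pow_dvd_pow_iff two_ne_zero).1 (hc.symm.pow.dvd_of_dvd_mul_left this)
  have hB : B₁ ^ 2 = B₂ ^ 2 := by
    rw [sq_eq_sq_iff_abs_eq_abs, Int.abs_eq_natAbs, Int.abs_eq_natAbs]
    exact_mod_cast Int.natAbs_eq_of_dvd_dvd (key h₁.coprime_AB h) (key h₂.coprime_AB h.symm)
  have hA : A₁ ^ 2 = A₂ ^ 2 := by
    rw [hB] at h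
    exact mul_right_cancel₀ (pow_ne_zero 2 h₂.B_ne_zero) h
  refine ⟨hB, ?_⟩
  rw [h₁.eq, h₂.eq, show A₁ ^ 4 = (A₁ ^ 2) ^ 2 by ring, show B₁ ^ 4 = (B₁ ^ 2) ^ 2 by ring, hA, hB]
  ring

end QuarticTriple

/-! ### Quartic sequences and divisibility of indices -/

/-- A sequence of coprime triples on the Jacobi quartic indexed by the nonzero integers, with
`A_n, C_n ≠ 0`, that is compatible with addition of indices and, up to signs, with negation. -/
structure QuarticSequence (a b : ℤ) (A B C : ℤ → ℤ) : Prop where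
  triple : ∀ n, n ≠ 0 → QuarticTriple a b (A n) (B n) (C n)
  A_ne_zero : ∀ n, n ≠ 0 → A n ≠ 0
  C_ne_zero : ∀ n, n ≠ 0 → C n ≠ 0
  add : ∀ k l, k ≠ 0 → l ≠ 0 → k + l ≠ 0 →
    QuarticTriple.SumRel b (A k) (B k) (C k) (A l) (B l) (C l) (A (k + l)) (B (k + l))
  neg : ∀ n, n ≠ 0 → B (-n) ^ 2 = B n ^ 2 ∧ C (-n) ^ 2 = C n ^ 2

namespace QuarticSequence

variable {a b : ℤ} {A B C : ℤ → ℤ}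

/-- The indices whose points reduce to the origin modulo `d`. -/
def kernel (h : QuarticSequence a b A B C) (d : ℤ) : AddSubgroup ℤ where
  carrier := {k | k = 0 ∨ d ∣ B k}
  zero_mem' := Or.inl rfl
  add_mem' := by
    rintro k l hk hl
    by_cases hk0 : k = 0
    · simpa [hk0] using hl
    by_cases hl0 : l = 0
    · simpa [hl0] using hk
    by_cases hkl : k + l = 0
    · exact Or.inl hkl
    · exact Or.inr (QuarticTriple.dvd_B_add (h.triple k hk0) (h.triple l hl0)
        (h.add k l hk0 hl0 hkl) (hk.resolve_left hk0) (hl.resolve_left hl0))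
  neg_mem' := by
    rintro k hk
    by_cases hk0 : k = 0
    · exact Or.inl (by simp [hk0])
    · refine Or.inr ((Int.pow_dvd_pow_iff two_ne_zero).1 ?_)
      rw [(h.neg k hk0).1]
      exact pow_dvd_pow_of_dvd (hk.resolve_left hk0) 2

theorem dvd_C_add_of_mem (h : QuarticSequence a b A B C) (hb : Squarefree b) {d k l : ℤ}
    (hk : k ≠ 0) (hkl : k + l ≠ 0) (hd : d ∣ C k) (hl : l ∈ h.kernel d) : d ∣ C (k + l) := by
  by_cases hl0 : l = 0
  · simpa [hl0] using hd
  · exact QuarticTriple.dvd_C_add (h.triple k hk) (h.triple l hl0) (h.triple _ hkl) hb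
      (h.add k l hk hl0 hkl) hd (hl.resolve_left hl0)

theorem two_mul_mem_of_dvd_C (h : QuarticSequence a b A B C) (hb : Squarefree b)
    (hab : Squarefree (a ^ 2 - 4 * b)) {d k : ℤ} (hk : k ≠ 0) (hd : d ∣ C k) :
    2 * k ∈ h.kernel d := by
  have hkk : k + k ≠ 0 := by omega
  rw [two_mul]
  exact Or.inr (QuarticTriple.dvd_B_double (h.add k k hk hk hkk) (hd.mul_left _)
    (((h.triple k hk).coprime_C_double hb hab).of_isCoprime_of_dvd_left hd))

theorem two_mul_mem_of_dvd_A (h : QuarticSequence a b A B C) (hb : Squarefree b)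
    {d k : ℤ} (hk : k ≠ 0) (hd : d ∣ A k) : 2 * k ∈ h.kernel d := by
  have hkk : k + k ≠ 0 := by omega
  rw [two_mul]
  exact Or.inr (QuarticTriple.dvd_B_double (h.add k k hk hk hkk) (hd.mul_right _)
    (((h.triple k hk).coprime_A_double hb).of_isCoprime_of_dvd_left hd))

/-- `C_m ∣ C_n` for odd multiples `n` of `m`: `2m` lies in the kernel of reduction modulo `C_m`, and
`n` differs from `m` by a multiple of `2m`. -/
theorem dvd_C_of_odd_mul (h : QuarticSequence a b A B C) (hb : Squarefree b)
    (hab : Squarefree (a ^ 2 - 4 * b)) {m k : ℤ} (hm : m ≠ 0) (hk : Odd k) :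
    C m ∣ C (m * k) := by
  obtain ⟨j, rfl⟩ := hk
  have hmem : j * (2 * m) ∈ h.kernel (C m) := by
    simpa using (h.kernel (C m)).zsmul_mem (h.two_mul_mem_of_dvd_C hb hab hm dvd_rfl) j
  have e : m * (2 * j + 1) = m + j * (2 * m) := by ring
  rw [e]
  refine h.dvd_C_add_of_mem hb hm ?_ dvd_rfl hmem
  rw [← e]
  exact mul_ne_zero hm (by omega)

/-- A primitive divisor `p` of `C_m` divides `A_n C_n` only if `m ∣ n`. With `e = gcd(m, n)`, the
point `2eP` reduces to the origin modulo `p`; `m / e` is odd because `mP` does not, so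
`eP ≡ mP`, and `p ∣ C_e` forces `e = m`. -/
theorem index_dvd_of_dvd (h : QuarticSequence a b A B C) (hb : Squarefree b)
    (hab : Squarefree (a ^ 2 - 4 * b)) {p m n : ℤ} (hp : Prime p) (hm : 0 < m) (hn : n ≠ 0)
    (hpm : p ∣ C m) (hprim : ∀ i, 0 < i → i < m → ¬ p ∣ C i) (hpn : p ∣ A n ∨ p ∣ C n) :
    m ∣ n := by
  have hm2 : 2 * m ∈ h.kernel p := h.two_mul_mem_of_dvd_C hb hab hm.ne' hpm
  have hn2 : 2 * n ∈ h.kernel p := by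
    rcases hpn with hpn | hpn
    · exact h.two_mul_mem_of_dvd_A hb hn hpn
    · exact h.two_mul_mem_of_dvd_C hb hab hn hpn
  obtain ⟨e, he⟩ : ∃ e : ℤ, e = (Int.gcd m n : ℤ) := ⟨_, rfl⟩
  have hem : e ∣ m := he ▸ Int.gcd_dvd_left ..
  have hen : e ∣ n := he ▸ Int.gcd_dvd_right ..
  have he0 : 0 < e := by
    rw [he]
    exact_mod_cast Int.gcd_pos_of_ne_zero_left n hm.ne'
  have he2 : 2 * e ∈ h.kernel p := by
    have hbez : 2 * e = Int.gcdA m n * (2 * m) + Int.gcdB m n * (2 * n) := by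
      rw [he, Int.gcd_eq_gcd_ab]
      ring
    rw [hbez]
    simpa using (h.kernel p).add_mem ((h.kernel p).zsmul_mem hm2 (Int.gcdA m n))
      ((h.kernel p).zsmul_mem hn2 (Int.gcdB m n))
  obtain ⟨k, hk⟩ := hem
  rcases Int.even_or_odd' k with ⟨j, hj | hj⟩
  · exfalso
    have hmK : m ∈ h.kernel p := by
      have := (h.kernel p).zsmul_mem he2 j
      rwa [smul_eq_mul, show j * (2 * e) = m by rw [hk, hj]; ring] at this
    exact hp.not_isUnit (((h.triple m hm.ne').coprime_BC).isUnit_of_dvd'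
      (hmK.resolve_left hm.ne') hpm)
  · have hej : e = m + -j * (2 * e) := by
      rw [hk, hj]
      ring
    have hpe : p ∣ C e := by
      have hmem : -j * (2 * e) ∈ h.kernel p := by
        simpa using (h.kernel p).zsmul_mem he2 (-j)
      have := h.dvd_C_add_of_mem hb hm.ne' (by rw [← hej]; exact he0.ne') hpm hmem
      rwa [← hej] at this
    have hme : m = e := le_antisymm (not_lt.1 fun hlt => hprim e he0 hlt hpe)
      (Int.le_of_dvd hm ⟨k, hk⟩)
    rw [hme]
    exact hen

end QuarticSequence

/-! ### From points of the curve to quartic sequences -/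

variable {a b : ℤ}

theorem sq_y_of_nonsingular {x y : ℚ} (h : (curve a b).toAffine.Nonsingular x y) :
    y ^ 2 = x ^ 3 + a * x ^ 2 + b * x := by
  have := (equation_iff x y).1 h.1
  simpa [curve] using this

theorem negY_curve (x y : ℚ) : (curve a b).toAffine.negY x y = -y := by
  simp [negY, curve]

theorem two_zsmul_of_y_eq_zero {x y : ℚ} (h : (curve a b).toAffine.Nonsingular x y) (hy : y = 0) :
    (2 : ℤ) • (Point.some x y h : Pt a b) = 0 := by
  rw [two_zsmul]
  exact Point.add_self_of_Y_eq (by rw [negY_curve, hy, neg_zero])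

/-- The duplication formula `x(2Q) = ((x² - b) / 2y)²`. -/
theorem x_double {x y x' y' : ℚ} (h : (curve a b).toAffine.Nonsingular x y)
    (h' : (curve a b).toAffine.Nonsingular x' y')
    (he : (Point.some x y h : Pt a b) + Point.some x y h = Point.some x' y' h') :
    y ≠ 0 ∧ x' * (2 * y) ^ 2 = (x ^ 2 - b) ^ 2 := by
  have e := sq_y_of_nonsingular h
  have hy : y ≠ 0 := by
    intro hy
    rw [← two_zsmul, two_zsmul_of_y_eq_zero h hy] at he
    exact Point.some_ne_zero h' he.symm
  have hne : y ≠ (curve a b).toAffine.negY x y := by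
    rw [negY_curve]
    intro h0
    apply hy
    linarith
  refine ⟨hy, ?_⟩
  rw [Point.add_self_of_Y_ne hne] at he
  have hx := (Point.some.inj he).1
  rw [slope_of_Y_ne rfl hne, negY_curve] at hx
  simp only [addX, curve] at hx
  rw [← hx]
  field_simp
  linear_combination (-4 * a - 8 * x) * 4 * e

/-- The addition formula on the Jacobi quartic, as a statement about the `x`-coordinate of the sum
of the points `(uᵢ², uᵢvᵢ)` of the curve. -/
theorem x_add {u₁ v₁ u₂ v₂ x₃ y₃ : ℚ} (hu₁ : v₁ ^ 2 = u₁ ^ 4 + a * u₁ ^ 2 + b)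
    (hu₂ : v₂ ^ 2 = u₂ ^ 4 + a * u₂ ^ 2 + b)
    (h₁ : (curve a b).toAffine.Nonsingular (u₁ ^ 2) (u₁ * v₁))
    (h₂ : (curve a b).toAffine.Nonsingular (u₂ ^ 2) (u₂ * v₂))
    (h₃ : (curve a b).toAffine.Nonsingular x₃ y₃)
    (he : (Point.some _ _ h₁ : Pt a b) + Point.some _ _ h₂ = Point.some _ _ h₃) :
    x₃ * (u₁ * v₂ + u₂ * v₁) ^ 2 = (u₁ ^ 2 * u₂ ^ 2 - b) ^ 2 := by
  by_cases hx : u₁ ^ 2 = u₂ ^ 2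
  · have hy : u₁ * v₁ = u₂ * v₂ := by
      by_contra hne
      have e₁ := sq_y_of_nonsingular h₁
      have e₂ := sq_y_of_nonsingular h₂
      rw [hx, ← e₂] at e₁
      refine Point.some_ne_zero h₃ (he.symm.trans (Point.add_of_Y_eq hx ?_))
      rw [negY_curve]
      exact (sq_eq_sq_iff_eq_or_eq_neg.1 e₁).resolve_left hne
    have hP : (Point.some _ _ h₂ : Pt a b) = Point.some _ _ h₁ := by
      simp only [Point.some.injEq]
      exact ⟨hx.symm, hy.symm⟩
    rw [hP] at he
    have hd := (x_double h₁ h₃ he).2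
    have hN : (u₁ * v₂ + u₂ * v₁) ^ 2 = (2 * (u₁ * v₁)) ^ 2 := by
      linear_combination (v₂ ^ 2 - v₁ ^ 2) * hx - (3 * u₁ * v₁ + u₂ * v₂) * hy
    rw [hN, hd, ← hx]
    ring
  · rw [Point.add_of_X_ne hx] at he
    have hx3 := (Point.some.inj he).1
    rw [slope_of_X_ne hx] at hx3
    simp only [addX, curve] at hx3
    have hne : u₁ ^ 2 - u₂ ^ 2 ≠ 0 := sub_ne_zero.2 hx
    have k : x₃ * (u₁ ^ 2 - u₂ ^ 2) ^ 2 = (u₁ * v₂ - u₂ * v₁) ^ 2 := by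
      rw [← hx3]
      field_simp
      linear_combination (u₁ ^ 2 - u₂ ^ 2) * (hu₁ - hu₂)
    have k2 : (u₁ * v₂ - u₂ * v₁) * (u₁ * v₂ + u₂ * v₁) =
        (u₂ ^ 2 - u₁ ^ 2) * (u₁ ^ 2 * u₂ ^ 2 - b) := by
      linear_combination u₁ ^ 2 * hu₂ - u₂ ^ 2 * hu₁
    refine mul_right_cancel₀ (pow_ne_zero 2 hne) ?_
    calc x₃ * (u₁ * v₂ + u₂ * v₁) ^ 2 * (u₁ ^ 2 - u₂ ^ 2) ^ 2
        = ((u₁ * v₂ - u₂ * v₁) * (u₁ * v₂ + u₂ * v₁)) ^ 2 := by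
          linear_combination (u₁ * v₂ + u₂ * v₁) ^ 2 * k
      _ = _ := by rw [k2]; ring

theorem zsmul_ne_zero_of_infinite {P : Pt a b} (hinf : ¬ IsOfFinAddOrder P) {n : ℤ} (hn : n ≠ 0) :
    n • P ≠ 0 := fun h => hinf (isOfFinAddOrder_iff_zsmul_eq_zero.2 ⟨n, hn, h⟩)

theorem y_ne_zero_of_infinite {P : Pt a b} (hinf : ¬ IsOfFinAddOrder P) {n : ℤ} (hn : n ≠ 0)
    {x y : ℚ} {h : (curve a b).toAffine.Nonsingular x y} (he : n • P = Point.some x y h) :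
    y ≠ 0 := by
  intro hy
  have h2 := two_zsmul_of_y_eq_zero h hy
  rw [← he, smul_smul] at h2
  exact zsmul_ne_zero_of_infinite hinf (by omega) h2

theorem Represents.quarticSequence {P : Pt a b} {A B C : ℤ → ℤ} (hrep : Represents P A B C)
    (hinf : ¬ IsOfFinAddOrder P) : QuarticSequence a b A B C := by
  have hy : ∀ n, n ≠ 0 → (A n : ℚ) * C n / (B n : ℚ) ^ 3 ≠ 0 := by
    intro n hn
    obtain ⟨-, -, -, h, he⟩ := hrep n hn
    exact y_ne_zero_of_infinite hinf hn he
  have hA : ∀ n, n ≠ 0 → A n ≠ 0 := by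
    intro n hn h0
    exact hy n hn (by simp [h0])
  have hC : ∀ n, n ≠ 0 → C n ≠ 0 := by
    intro n hn h0
    exact hy n hn (by simp [h0])
  have hq : ∀ n, n ≠ 0 → ((C n : ℚ) / B n ^ 2) ^ 2 =
      ((A n : ℚ) / B n) ^ 4 + a * ((A n : ℚ) / B n) ^ 2 + b := by
    intro n hn
    obtain ⟨hB, -, -, h, -⟩ := hrep n hn
    have hB' : (B n : ℚ) ≠ 0 := by exact_mod_cast hB
    have hA' : (A n : ℚ) ≠ 0 := by exact_mod_cast hA n hn
    have e := sq_y_of_nonsingular h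
    refine mul_left_cancel₀ (pow_ne_zero 2 (div_ne_zero hA' hB')) ?_
    calc ((A n : ℚ) / B n) ^ 2 * ((C n : ℚ) / B n ^ 2) ^ 2
        = ((A n : ℚ) * C n / (B n : ℚ) ^ 3) ^ 2 := by field_simp
      _ = _ := by rw [e]; ring
  have htriple : ∀ n, n ≠ 0 → QuarticTriple a b (A n) (B n) (C n) := by
    intro n hn
    obtain ⟨hB, hAB, hBC, h, he⟩ := hrep n hn
    refine ⟨hB, hAB, hBC, ?_⟩
    have hB' : (B n : ℚ) ≠ 0 := by exact_mod_cast hB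
    have e := hq n hn
    field_simp at e
    have e' : (C n : ℚ) ^ 2 = A n ^ 4 + a * A n ^ 2 * B n ^ 2 + b * B n ^ 4 := by
      linear_combination e
    exact_mod_cast e'
  refine ⟨htriple, hA, hC, ?_, ?_⟩
  · intro k l hk hl hkl
    obtain ⟨hB₁, -, -, h₁, he₁⟩ := hrep k hk
    obtain ⟨hB₂, -, -, h₂, he₂⟩ := hrep l hl
    obtain ⟨hB₃, -, -, h₃, he₃⟩ := hrep (k + l) hkl
    have q₁ := hq k hk
    have q₂ := hq l hl
    have hB₁' : (B k : ℚ) ≠ 0 := by exact_mod_cast hB₁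
    have hB₂' : (B l : ℚ) ≠ 0 := by exact_mod_cast hB₂
    have hB₃' : (B (k + l) : ℚ) ≠ 0 := by exact_mod_cast hB₃
    have hsplit : ∀ n : ℤ, (A n : ℚ) * C n / (B n : ℚ) ^ 3 = (A n : ℚ) / B n * (C n / B n ^ 2) := by
      intro n
      rw [div_mul_div_comm]
      ring
    rw [add_zsmul, he₁, he₂] at he₃
    simp only [hsplit] at he₃ h₁ h₂ h₃
    have key := x_add q₁ q₂ h₁ h₂ h₃ he₃
    field_simp at key
    unfold QuarticTriple.SumRel
    have key' : (A (k + l) : ℚ) ^ 2 * (A k * B k * C l + A l * B l * C k) ^ 2 =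
        B (k + l) ^ 2 * (A k ^ 2 * A l ^ 2 - b * B k ^ 2 * B l ^ 2) ^ 2 := by
      linear_combination key
    exact_mod_cast key'
  · intro n hn
    have hn' : -n ≠ 0 := neg_ne_zero.2 hn
    obtain ⟨hB₁, -, -, h₁, he₁⟩ := hrep n hn
    obtain ⟨hB₂, -, -, h₂, he₂⟩ := hrep (-n) hn'
    rw [neg_zsmul, he₁, Point.neg_some] at he₂
    have hx := (Point.some.inj he₂).1
    have hB₁' : (B n : ℚ) ≠ 0 := by exact_mod_cast hB₁
    have hB₂' : (B (-n) : ℚ) ≠ 0 := by exact_mod_cast hB₂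
    field_simp at hx
    refine QuarticTriple.sq_eq_of_ratio (htriple _ hn') (htriple n hn) ?_
    have hx' : (A (-n) : ℚ) ^ 2 * B n ^ 2 = A n ^ 2 * B (-n) ^ 2 := by linear_combination -hx
    exact_mod_cast hx'

/-- A nonzero multiple `nP` of a doubled point is the double of an affine point `(x, y)`, so its
`x`-coordinate is the square of `r = (x² - b) / 2y`. The quotient `y(nP) / r` is then a rational
number whose product with the square of the denominator of `r` is integral. -/
theorem exists_represents {P : Pt a b} (hP : ∃ Q : Pt a b, P = (2 : ℤ) • Q)
    (hinf : ¬ IsOfFinAddOrder P) : ∃ A B C : ℤ → ℤ, Represents P A B C := by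
  obtain ⟨Q, rfl⟩ := hP
  suffices H : ∀ n : ℤ, ∃ A B C : ℤ, n ≠ 0 → B ≠ 0 ∧ IsCoprime A B ∧ IsCoprime B C ∧
      ∃ h : (curve a b).toAffine.Nonsingular
        (((A : ℚ) / (B : ℚ)) ^ 2) ((A : ℚ) * (C : ℚ) / (B : ℚ) ^ 3),
      n • ((2 : ℤ) • Q) = Point.some _ _ h by
    choose A B C h using H
    exact ⟨A, B, C, h⟩
  intro n
  by_cases hn : n = 0
  · exact ⟨0, 0, 0, fun h => absurd hn h⟩
  have hne := zsmul_ne_zero_of_infinite hinf hn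
  have hdouble : n • ((2 : ℤ) • Q) = n • Q + n • Q := by
    rw [smul_comm, two_zsmul]
  rcases hQ : n • Q with _ | ⟨x, y, hxy⟩
  · rw [hdouble, hQ] at hne
    exact absurd (add_zero (0 : Pt a b)) hne
  rcases hX : n • ((2 : ℤ) • Q) with _ | ⟨x', y', hxy'⟩
  · exact absurd hX hne
  have hy' : y' ≠ 0 := y_ne_zero_of_infinite hinf hn hX
  have hX' := hX
  rw [hdouble, hQ] at hX'
  obtain ⟨hy, hx'⟩ := x_double hxy hxy' hX'
  obtain ⟨r, hr⟩ : ∃ r : ℚ, r = (x ^ 2 - b) / (2 * y) := ⟨_, rfl⟩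
  have hrx : x' = r ^ 2 := by
    rw [hr, div_pow, eq_div_iff (pow_ne_zero 2 (mul_ne_zero two_ne_zero hy)), hx']
  have e := sq_y_of_nonsingular hxy'
  have hr0 : r ≠ 0 := by
    rintro h0
    rw [hrx, h0] at e
    exact hy' (pow_eq_zero_iff (two_ne_zero) |>.1 (by rw [e]; ring))
  have hden : (r.den : ℚ) ≠ 0 := by exact_mod_cast r.den_nz
  have hrnd : r = (r.num : ℚ) / (r.den : ℚ) := (Rat.num_div_den r).symm
  have hc : (y' / r * r.den ^ 2) ^ 2 =
      ((r.num ^ 4 + a * r.num ^ 2 * r.den ^ 2 + b * r.den ^ 4 : ℤ) : ℚ) := by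
    have hmul : r * r.den = r.num := Rat.mul_den_eq_num r
    push_cast
    rw [← hmul, mul_pow, div_pow, e, hrx]
    field_simp
  obtain ⟨c, hcc⟩ : ∃ c : ℤ, (c : ℚ) = y' / r * r.den ^ 2 := by
    have hint : IsIntegral ℤ (y' / r * (r.den : ℚ) ^ 2) := by
      refine IsIntegral.of_pow (n := 2) two_pos ?_
      rw [hc]
      exact isIntegral_algebraMap
    exact IsIntegrallyClosed.isIntegral_iff.1 hint
  have hcop : IsCoprime r.num (r.den : ℤ) := by
    rw [Int.isCoprime_iff_gcd_eq_one]
    exact r.reduced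
  have hceq : c ^ 2 = r.num ^ 4 + a * r.num ^ 2 * r.den ^ 2 + b * r.den ^ 4 := by
    rw [← hcc] at hc
    exact_mod_cast hc
  have hxe : x' = ((r.num : ℚ) / ((r.den : ℤ) : ℚ)) ^ 2 := by
    rw [hrx, Int.cast_natCast, Rat.num_div_den]
  have hye : y' = (r.num : ℚ) * (c : ℚ) / ((r.den : ℤ) : ℚ) ^ 3 := by
    have hmul : r * r.den = r.num := Rat.mul_den_eq_num r
    rw [hcc, ← hmul, Int.cast_natCast]
    field_simp
  refine ⟨r.num, r.den, c, fun _ => ⟨by exact_mod_cast r.den_nz, hcop, ?_, ?_⟩⟩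
  · have h1 : IsCoprime (r.den : ℤ) (c ^ 2) := by
      have := (hcop.symm.pow_right (n := 4)).add_mul_left_right
        (a * r.num ^ 2 * r.den + b * r.den ^ 3)
      convert! this using 1
      rw [hceq]
      ring
    exact (IsCoprime.pow_right_iff two_pos).1 h1
  · subst hxe hye
    exact ⟨hxy', rfl⟩

/-! ### The divisibility predicate -/

theorem not_isYSqrtX_zero (t : ℚ) : ¬ IsYSqrtX (0 : Pt a b) t := by
  rintro ⟨x, y, h, s, h0, -⟩
  exact Point.some_ne_zero h h0.symm

theorem Represents.isYSqrtX_iff {P : Pt a b} {A B C : ℤ → ℤ} (hrep : Represents P A B C) {n : ℤ}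
    (hn : n ≠ 0) (t : ℚ) : IsYSqrtX (n • P) t ↔
      t = (A n : ℚ) ^ 2 * C n / B n ^ 4 ∨ t = -((A n : ℚ) ^ 2 * C n / B n ^ 4) := by
  obtain ⟨hB, -, -, h, he⟩ := hrep n hn
  rw [he]
  constructor
  · rintro ⟨x, y, h', s, heq, hs, rfl⟩
    obtain ⟨hx, hy⟩ := Point.some.inj heq
    rw [← hx] at hs
    rcases sq_eq_sq_iff_eq_or_eq_neg.1 hs with hs | hs
    · left
      rw [hs, ← hy, div_mul_div_comm]
      ring
    · right
      rw [hs, ← hy, mul_neg, div_mul_div_comm]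
      ring
  · rintro (rfl | rfl)
    · exact ⟨_, _, h, (A n : ℚ) / B n, rfl, rfl, by rw [div_mul_div_comm]; ring⟩
    · exact ⟨_, _, h, -((A n : ℚ) / B n), rfl, by ring, by rw [mul_neg, div_mul_div_comm]; ring⟩

theorem divPred_neg_left {R : Set Nat.Primes} {x y : ℚ} :
    DivPred R (-x) y ↔ DivPred R x y := by
  simp [DivPred]

theorem divPred_neg_right {R : Set Nat.Primes} {x y : ℚ} :
    DivPred R x (-y) ↔ DivPred R x y := by
  simp [DivPred]

theorem Represents.pointDivPred_iff {P : Pt a b} {A B C : ℤ → ℤ} (hrep : Represents P A B C)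
    (R : Set Nat.Primes) {m n : ℤ} (hm : m ≠ 0) : PointDivPred R (m • P) (n • P) ↔
      n ≠ 0 ∧ DivPred R ((A m : ℚ) ^ 2 * C m / B m ^ 4) ((A n : ℚ) ^ 2 * C n / B n ^ 4) := by
  constructor
  · rintro ⟨t, t', ht, ht', hD⟩
    have hn : n ≠ 0 := by
      rintro rfl
      rw [zero_zsmul] at ht'
      exact not_isYSqrtX_zero t' ht'
    refine ⟨hn, ?_⟩
    rcases (hrep.isYSqrtX_iff hm t).1 ht with rfl | rfl <;>
      rcases (hrep.isYSqrtX_iff hn t').1 ht' with rfl | rfl <;>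
      simpa only [divPred_neg_left, divPred_neg_right] using hD
  · rintro ⟨hn, hD⟩
    exact ⟨_, _, (hrep.isYSqrtX_iff hm _).2 (Or.inl rfl), (hrep.isYSqrtX_iff hn _).2 (Or.inl rfl),
      hD⟩

namespace QuarticSequence

variable {A B C : ℤ → ℤ}

theorem padicValRat_eq (h : QuarticSequence a b A B C) {n : ℤ} (hn : n ≠ 0) (p : ℕ)
    [Fact p.Prime] : padicValRat p ((A n : ℚ) ^ 2 * C n / B n ^ 4) =
      2 * padicValInt p (A n) + padicValInt p (C n) - 4 * padicValInt p (B n) := by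
  have hA : (A n : ℚ) ≠ 0 := by exact_mod_cast h.A_ne_zero n hn
  have hB : (B n : ℚ) ≠ 0 := by exact_mod_cast (h.triple n hn).B_ne_zero
  have hC : (C n : ℚ) ≠ 0 := by exact_mod_cast h.C_ne_zero n hn
  rw [padicValRat.div (mul_ne_zero (pow_ne_zero 2 hA) hC) (pow_ne_zero 4 hB),
    padicValRat.mul (pow_ne_zero 2 hA) hC, padicValRat.pow, padicValRat.pow, padicValRat.of_int,
    padicValRat.of_int, padicValRat.of_int]
  norm_num

/-- At a prime dividing `C_n`, the number `A_n² C_n / B_n⁴` has the same valuation as `C_n`. -/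
theorem padicValRat_eq_of_dvd (h : QuarticSequence a b A B C) (hb : Squarefree b) {n : ℤ}
    (hn : n ≠ 0) (p : ℕ) [hp : Fact p.Prime] (hpC : (p : ℤ) ∣ C n) :
    padicValRat p ((A n : ℚ) ^ 2 * C n / B n ^ 4) = padicValInt p (C n) := by
  have hpu : ¬ IsUnit (p : ℤ) := (Nat.prime_iff_prime_int.1 hp.out).not_isUnit
  have hA : padicValInt p (A n) = 0 := padicValInt.eq_zero_of_not_dvd fun hd =>
    hpu (((h.triple n hn).coprime_AC hb).isUnit_of_dvd' hd hpC)
  have hB : padicValInt p (B n) = 0 := padicValInt.eq_zero_of_not_dvd fun hd =>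
    hpu ((h.triple n hn).coprime_BC.isUnit_of_dvd' hd hpC)
  rw [h.padicValRat_eq hn, hA, hB]
  norm_num

theorem divPred_of_odd_mul (h : QuarticSequence a b A B C) (hb : Squarefree b)
    (hab : Squarefree (a ^ 2 - 4 * b)) (R : Set Nat.Primes) {m k : ℤ} (hm : m ≠ 0) (hk : Odd k) :
    DivPred R ((A m : ℚ) ^ 2 * C m / B m ^ 4)
      ((A (m * k) : ℚ) ^ 2 * C (m * k) / B (m * k) ^ 4) := by
  rintro ⟨p, hp⟩ - hodd
  have : Fact p.Prime := ⟨hp⟩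
  have hmk : m * k ≠ 0 := mul_ne_zero hm (by rintro rfl; exact absurd hk (by decide))
  right
  have hpC : (p : ℤ) ∣ C m := by
    by_contra hnd
    rw [h.padicValRat_eq hm, padicValInt.eq_zero_of_not_dvd hnd] at hodd
    obtain ⟨j, hj⟩ := hodd
    push_cast at hj
    omega
  have hdvd := h.dvd_C_of_odd_mul hb hab hm hk
  have hle : padicValInt p (C m) ≤ padicValInt p (C (m * k)) :=
    ((padicValInt_dvd_iff _ _).1 (((padicValInt_dvd (C m)).trans hdvd))).resolve_left
      (h.C_ne_zero _ hmk)
  have hpos : 0 < padicValInt p (C m) := by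
    rw [pos_iff_ne_zero, Ne, padicValInt.eq_zero_iff]
    rintro (h1 | h1 | h1)
    · exact hp.one_lt.ne' h1
    · exact h.C_ne_zero m hm h1
    · exact h1 hpC
  show padicValRat p _ < padicValRat p _
  rw [padicValRat.pow, h.padicValRat_eq_of_dvd hb hm p hpC,
    h.padicValRat_eq_of_dvd hb hmk p (hpC.trans hdvd)]
  push_cast
  omega

theorem index_dvd_of_divPred (h : QuarticSequence a b A B C) (hb : Squarefree b)
    (hab : Squarefree (a ^ 2 - 4 * b)) {R : Set Nat.Primes} (hR : OddPrimitive R C) {m n : ℤ}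
    (hm : m ≠ 0) (hn : n ≠ 0)
    (hD : DivPred R ((A m : ℚ) ^ 2 * C m / B m ^ 4) ((A n : ℚ) ^ 2 * C n / B n ^ 4)) :
    m ∣ n := by
  obtain ⟨⟨p, hp⟩, hpR, hodd, hprim⟩ := hR |m| (abs_pos.2 hm)
  have : Fact p.Prime := ⟨hp⟩
  change Odd (padicValInt p (C |m|)) at hodd
  change ∀ i : ℤ, 0 < i → i < |m| → ¬ (p : ℤ) ∣ C i at hprim
  have habs : (C |m|).natAbs = (C m).natAbs := by
    rcases abs_choice m with h1 | h1
    · rw [h1]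
    · rw [h1, Int.natAbs_eq_iff_sq_eq]
      exact (h.neg m hm).2
  have hpabs : (p : ℤ) ∣ C |m| := by
    by_contra hnd
    rw [padicValInt.eq_zero_of_not_dvd hnd] at hodd
    exact absurd hodd (by decide)
  have hpm : (p : ℤ) ∣ C m := by
    rwa [← Int.dvd_natAbs, ← habs, Int.dvd_natAbs]
  have hval : padicValInt p (C |m|) = padicValInt p (C m) := by
    rw [padicValInt, padicValInt, habs]
  have hvm := h.padicValRat_eq_of_dvd hb hm p hpm
  have hA : (A n : ℚ) ≠ 0 := by exact_mod_cast h.A_ne_zero n hn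
  have hB : (B n : ℚ) ≠ 0 := by exact_mod_cast (h.triple n hn).B_ne_zero
  have hC : (C n : ℚ) ≠ 0 := by exact_mod_cast h.C_ne_zero n hn
  have hlt := (hD ⟨p, hp⟩ hpR (by
    change Odd (padicValRat p _)
    rw [hvm, ← hval]
    exact_mod_cast hodd)).resolve_left
      (div_ne_zero (mul_ne_zero (pow_ne_zero 2 hA) hC) (pow_ne_zero 4 hB))
  change padicValRat p _ < padicValRat p _ at hlt
  rw [hvm, padicValRat.pow, h.padicValRat_eq hn] at hlt
  have hpn : (p : ℤ) ∣ A n ∨ (p : ℤ) ∣ C n := by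
    by_contra! hno
    rw [padicValInt.eq_zero_of_not_dvd hno.1, padicValInt.eq_zero_of_not_dvd hno.2] at hlt
    push_cast at hlt
    omega
  exact (abs_dvd m n).1 (h.index_dvd_of_dvd hb hab (Nat.prime_iff_prime_int.1 hp) (abs_pos.2 hm) hn
    hpabs hprim hpn)

end QuarticSequence

end OddDiv

theorem mainTheorem3 (a b : ℤ) (hb : Squarefree b) (hab : Squarefree (a ^ 2 - 4 * b))
    (P : OddDiv.Pt a b) (hP : ∃ Q : OddDiv.Pt a b, P = (2 : ℤ) • Q)
    (hinf : ¬ IsOfFinAddOrder P) :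
    (∃ A B C : ℤ → ℤ, OddDiv.Represents P A B C) ∧
    ∀ A B C : ℤ → ℤ, OddDiv.Represents P A B C →
      ∀ R : Set Nat.Primes, OddDiv.OddPrimitive R C →
        ∀ m n : ℤ, m ≠ 0 →
          (m ∣ n ↔
            OddDiv.PointDivPred R (m • P) (n • P) ∨
            OddDiv.PointDivPred R (m • P) ((m + n) • P)) := by
  refine ⟨OddDiv.exists_represents hP hinf, fun A B C hrep R hR m n hm => ?_⟩
  have h := hrep.quarticSequence hinf
  rw [hrep.pointDivPred_iff R hm, hrep.pointDivPred_iff R hm]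
  constructor
  · rintro ⟨k, rfl⟩
    -- Exactly one of `k` and `k + 1` is odd, and an odd multiple of `m` is nonzero.
    rcases Int.even_or_odd k with hk | hk
    · right
      have hk1 : Odd (k + 1) := hk.add_one
      rw [show m + m * k = m * (k + 1) by ring]
      exact ⟨mul_ne_zero hm (by rintro h0; rw [h0] at hk1; exact absurd hk1 (by decide)),
        h.divPred_of_odd_mul hb hab R hm hk1⟩
    · left
      exact ⟨mul_ne_zero hm (by rintro rfl; exact absurd hk (by decide)),
        h.divPred_of_odd_mul hb hab R hm hk⟩
  · rintro (⟨hn, hD⟩ | ⟨hn, hD⟩)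
    · exact h.index_dvd_of_divPred hb hab hR hm hn hD
    · exact (dvd_add_right dvd_rfl).1 (h.index_dvd_of_divPred hb hab hR hm hn hD)
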